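/- Let $d\ge 1$ be an integer and $\beta>2$. Write $w_\beta(t)=\exp(-\beta\|t\|^2)$ for $t\in\mathbb{R}^d$, let $\mathrm{L}^2_\beta=\mathrm{L}^2(\mathbb{R}^d,\mathcal{B}^d,w_\beta(t)\,\mathrm{d}t)$, and put \[ C(s,t)=\exp\Big(\frac{\|s\|^2+\|t\|^2}{2}\Big)\Big(\mathrm{e}^{s^\top t}-1-s^\top t-\frac{(s^\top t)^2}{2}\Big),\qquad s,t\in\mathbb{R}^d . \] There exists a centred Gaussian random element $W$ of $\mathrm{L}^2_\beta$ with covariance kernel $C$, i.e. with $\operatorname{Cov}(\langle f,W\rangle,\langle g,W\rangle)=\iint C(s,t)f(s)g(t)w_\beta(s)w_\beta(t)\,\mathrm{d}s\,\mathrm{d}t$ for all $f,g\in \mathrm{L}^2_\beta$. For every such $W$, the random variable $T_{\infty,\beta}=\|W\|^2_{\mathrm{L}^2_\beta}$ is square integrable, and, with $\eta=4(\beta-1)^2-1$, \[ \mathbb{E}(T_{\infty,\beta})=\pi^{d/2}\left(\frac{1}{(\beta-2)^{d/2}}-\frac{1}{(\beta-1)^{d/2}}-\frac{d}{2(\beta-1)^{d/2+1}}-\frac{d(d+2)}{8(\beta-1)^{d/2+2}}\right)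 \] and \[ \mathbb{V}(T_{\infty,\beta})=2\pi^d\left(\frac{1}{(\beta(\beta-2))^{d/2}}-\frac{2^{d+1}}{\eta^{d/2}}-\frac{3d\,2^d}{\eta^{d/2+1}}-\frac{d(d+2)2^d}{\eta^{d/2+2}}+\frac{1}{(\beta-1)^d}+\frac{d}{2(\beta-1)^{d+2}}+\frac{3d(d+2)}{64(\beta-1)^{d+4}}\right). \] -/

import Mathlib

open MeasureTheory ProbabilityTheory
open scoped ENNReal RealInnerProductSpace

noncomputable section

/-- The finite measure `exp (-β ‖t‖²) dt` on `ℝ^d`. -/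
def weightMeasure (d : ℕ) (β : ℝ) : Measure (EuclideanSpace ℝ (Fin d)) :=
  volume.withDensity fun t => ENNReal.ofReal (Real.exp (-β * ‖t‖ ^ 2))

/-- The real Hilbert space `L²_β = L²(ℝ^d, Borel, exp (-β ‖t‖²) dt)`. -/
abbrev L2Weight (d : ℕ) (β : ℝ) : Type :=
  Lp ℝ 2 (weightMeasure d β)

instance instMeasurableSpaceL2Weight (d : ℕ) (β : ℝ) : MeasurableSpace (L2Weight d β) :=
  borel _

instance instBorelSpaceL2Weight (d : ℕ) (β : ℝ) : BorelSpace (L2Weight d β) :=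
  ⟨rfl⟩

/-- The covariance kernel
`C(s,t) = exp ((‖s‖² + ‖t‖²)/2) (exp (sᵀt) - 1 - sᵀt - (sᵀt)²/2)`. -/
def limitKernel {d : ℕ} (s t : EuclideanSpace ℝ (Fin d)) : ℝ :=
  Real.exp ((‖s‖ ^ 2 + ‖t‖ ^ 2) / 2) *
    (Real.exp ⟪s, t⟫ - 1 - ⟪s, t⟫ - ⟪s, t⟫ ^ 2 / 2)

/-- `W` is a centred Gaussian random element of `L²_β` with covariance kernel `C`: its law is a
Gaussian measure on `L²_β` (every continuous linear functional of it is real Gaussian), its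
expectation is `0`, and for all `f, g` in `L²_β` the covariance of `⟨f, W⟩` and `⟨g, W⟩` is
`∫∫ C(s,t) f(s) g(t) w_β(s) w_β(t) ds dt`. -/
structure IsCentredGaussianWithKernel {d : ℕ} {β : ℝ} {Ω : Type*} [MeasurableSpace Ω]
    (C : EuclideanSpace ℝ (Fin d) → EuclideanSpace ℝ (Fin d) → ℝ)
    (W : Ω → L2Weight d β) (P : Measure Ω) : Prop where
  aemeasurable : AEMeasurable W P
  gaussian : HasGaussianLaw W P
  centred : ∫ ω, W ω ∂P = 0
  covariance_eq : ∀ f g : L2Weight d β,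
    cov[fun ω => ⟪f, W ω⟫, fun ω => ⟪g, W ω⟫; P] =
      ∫ s, ∫ t, C s t * f s * g t ∂(weightMeasure d β) ∂(weightMeasure d β)

end

/-! Let K be the integral operator on L²_β with kernel C, the covariance operator of W. Expanding
‖W‖² by Parseval in a Hilbert basis gives E‖W‖² = tr K. Isserlis' formula E[X²Y²] = E[X²]E[Y²] +
2E[XY]² for jointly Gaussian coordinates gives E‖W‖⁴ = (tr K)² + 2‖K‖²_HS, so the variance is
2‖K‖²_HS.

The kernel is a sum of rank-one kernels h_k(s) h_k(t): the exponential series of sᵀt is expanded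
into words in the coordinates (`hasSum_kernelFeature_mul`). Since Σ‖h_k‖² = ∫ C(t,t) w_β(t) dt is
finite, the series Σ ξ_k h_k with independent standard normal ξ_k converges in L²(Ω; L²_β), which
yields existence (`exists_hasGaussianLaw_of_summable`). The same expansion identifies tr K with this
integral, and Parseval applied in each variable identifies ‖K‖²_HS with the double integral of C²
(`HilbertBasis.hasSum_sq_kernel`).

Both integrals are combinations of moments of ‖t‖² or sᵀt under exponential tilts. These moments are
derivatives in c of ∫ exp(c‖t‖²) w_β = (π/(β-c))^(d/2) and of ∬ exp(c sᵀt) w_a w_a = π^d (a² -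
c²/4)^(-d/2), taken at a = β - 1. There c = 2, 1, 0 produce β(β-2), η/4 and (β-1)². -/

lemma HasDerivAt.eq_of_eqOn {f g : ℝ → ℝ} {f' g' x : ℝ} {U : Set ℝ} (hU : IsOpen U)
    (hfg : Set.EqOn f g U) (hx : x ∈ U) (hf : HasDerivAt f f' x) (hg : HasDerivAt g g' x) :
    f' = g' :=
  hf.unique (hg.congr_of_eventuallyEq (hfg.eventuallyEq_of_mem (hU.mem_nhds hx)))

/-! ### Moments of Gaussian elements of a Hilbert space. -/

namespace ProbabilityTheory.HasGaussianLaw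

variable {Ω : Type*} {mΩ : MeasurableSpace Ω} {P : Measure Ω}

/-- The fourth moment of a centred real Gaussian variable is three times its squared variance. -/
lemma integral_pow_four {X : Ω → ℝ} (hX : HasGaussianLaw X P) (h0 : ∫ ω, X ω ∂P = 0) :
    ∫ ω, X ω ^ 4 ∂P = 3 * (∫ ω, X ω ^ 2 ∂P) ^ 2 := by
  have : IsProbabilityMeasure P := hX.isProbabilityMeasure
  set v := Var[X; P].toNNReal with hv
  have hmap : P.map X = gaussianReal 0 v := by rw [hX.map_eq_gaussianReal, h0]
  have hset : integrableExpSet X P = Set.univ := by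
    ext t
    simp only [integrableExpSet, Set.mem_ofPred_eq, Set.mem_univ, iff_true]
    have := integrable_exp_mul_gaussianReal (μ := 0) (v := v) t
    rw [← hmap] at this
    exact this.comp_aemeasurable hX.aemeasurable
  -- Differentiating ∫ Xⁿ exp(tX) in t raises n by one, so four derivatives of the moment generating
  -- function exp(vt²/2) reach the fourth moment at t = 0.
  have hmom (n : ℕ) (t : ℝ) := hasDerivAt_integral_pow_mul_exp_real (X := X) (μ := P) (t := t)
    (by simp [hset]) n
  have he (t : ℝ) : HasDerivAt (fun t : ℝ => Real.exp (v * t ^ 2 / 2))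
      (v * t * Real.exp (v * t ^ 2 / 2)) t := by
    have h := (((hasDerivAt_id t).pow 2).const_mul (v : ℝ)).div_const 2
    refine h.exp.congr_deriv ?_
    simp only [id, Pi.pow_apply]
    push_cast
    ring
  have h₀ (t : ℝ) : ∫ ω, X ω ^ 0 * Real.exp (t * X ω) ∂P = Real.exp (v * t ^ 2 / 2) := by
    have := mgf_gaussianReal hmap t
    simpa [mgf] using this
  have h₁ (t : ℝ) : ∫ ω, X ω ^ 1 * Real.exp (t * X ω) ∂P = v * t * Real.exp (v * t ^ 2 / 2) :=
    (hmom 0 t).eq_of_eqOn isOpen_univ (fun t _ => h₀ t) trivial (he t)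
  have h₂ (t : ℝ) : ∫ ω, X ω ^ 2 * Real.exp (t * X ω) ∂P
      = (v + v ^ 2 * t ^ 2) * Real.exp (v * t ^ 2 / 2) :=
    (hmom 1 t).eq_of_eqOn isOpen_univ (fun t _ => h₁ t) trivial
      ((((hasDerivAt_id t).const_mul (v : ℝ)).mul (he t)).congr_deriv (by simp; ring))
  have h₃ (t : ℝ) : ∫ ω, X ω ^ 3 * Real.exp (t * X ω) ∂P
      = (3 * v ^ 2 * t + v ^ 3 * t ^ 3) * Real.exp (v * t ^ 2 / 2) :=
    (hmom 2 t).eq_of_eqOn isOpen_univ (fun t _ => h₂ t) trivial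
      ((((((hasDerivAt_id t).pow 2).const_mul ((v : ℝ) ^ 2)).const_add (v : ℝ)).mul
        (he t)).congr_deriv (by simp; ring))
  have h₄ : ∫ ω, X ω ^ 4 * Real.exp (0 * X ω) ∂P
      = (3 * v ^ 2 + 6 * v ^ 3 * 0 ^ 2 + v ^ 4 * 0 ^ 4) * Real.exp (v * 0 ^ 2 / 2) :=
    (hmom 3 0).eq_of_eqOn isOpen_univ (fun t _ => h₃ t) trivial
      (((((hasDerivAt_id (0 : ℝ)).const_mul (3 * (v : ℝ) ^ 2)).add
        (((hasDerivAt_id (0 : ℝ)).pow 3).const_mul ((v : ℝ) ^ 3))).mul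
        (he 0)).congr_deriv (by simp))
  have h₂' := h₂ 0
  simp only [zero_mul, Real.exp_zero, mul_one] at h₂' h₄
  rw [h₂', h₄]
  simp

variable {H : Type*} [NormedAddCommGroup H] [InnerProductSpace ℝ H] [MeasurableSpace H]
  [BorelSpace H] {W : Ω → H}

lemma inner_left (hW : HasGaussianLaw W P) (f : H) : HasGaussianLaw (fun ω => ⟪f, W ω⟫) P :=
  hW.map_fun (innerSL ℝ f)

lemma _root_.HilbertBasis.hasSum_sq_inner {ι H : Type*} [NormedAddCommGroup H]
    [InnerProductSpace ℝ H] (b : HilbertBasis ι ℝ H) (x : H) :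
    HasSum (fun i => ⟪b i, x⟫ ^ 2) (‖x‖ ^ 2) := by
  have := b.hasSum_inner_mul_inner x x
  rw [real_inner_self_eq_norm_sq] at this
  refine this.congr_fun fun i => ?_
  rw [real_inner_comm x, sq]

lemma integral_norm_sq_eq {ι : Type*} [Countable ι] (b : HilbertBasis ι ℝ H) {τ : ℝ}
    (hW : HasGaussianLaw W P) (hτ : HasSum (fun i => ∫ ω, ⟪b i, W ω⟫ ^ 2 ∂P) τ) : ∫ ω, ‖W ω‖ ^ 2 ∂P = τ := by
  have h := hasSum_integral_of_summable_integral_norm (μ := P) (F := fun i ω => ⟪b i, W ω⟫ ^ 2)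
    (fun i => (hW.inner_left (b i)).memLp_two.integrable_sq) (by simpa using hτ.summable)
  rw [← h.unique hτ]
  refine integral_congr_ae (.of_forall fun ω => ?_)
  exact (b.hasSum_sq_inner (W ω)).tsum_eq.symm

variable [CompleteSpace H] [SecondCountableTopology H]

lemma integral_inner_eq_zero (hW : HasGaussianLaw W P) (h0 : ∫ ω, W ω ∂P = 0) (f : H) :
    ∫ ω, ⟪f, W ω⟫ ∂P = 0 := by
  rw [_root_.integral_inner hW.integrable, h0, inner_zero_right]

lemma covariance_inner (hW : HasGaussianLaw W P) (h0 : ∫ ω, W ω ∂P = 0) (f g : H) :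
    cov[fun ω => ⟪f, W ω⟫, fun ω => ⟪g, W ω⟫; P] = ∫ ω, ⟪f, W ω⟫ * ⟪g, W ω⟫ ∂P := by
  simp [covariance, hW.integral_inner_eq_zero h0]

/-- Isserlis' formula for the squares of two coordinates of a centred Gaussian element. -/
lemma integral_sq_inner_mul_sq_inner (hW : HasGaussianLaw W P) (h0 : ∫ ω, W ω ∂P = 0) (f g : H) :
    ∫ ω, ⟪f, W ω⟫ ^ 2 * ⟪g, W ω⟫ ^ 2 ∂P =
      (∫ ω, ⟪f, W ω⟫ ^ 2 ∂P) * (∫ ω, ⟪g, W ω⟫ ^ 2 ∂P) +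
        2 * (∫ ω, ⟪f, W ω⟫ * ⟪g, W ω⟫ ∂P) ^ 2 := by
  have hp (f : H) : ∫ ω, ⟪f, W ω⟫ ^ 4 ∂P = 3 * (∫ ω, ⟪f, W ω⟫ ^ 2 ∂P) ^ 2 :=
    (hW.inner_left f).integral_pow_four (hW.integral_inner_eq_zero h0 f)
  have hi (f : H) : Integrable (fun ω => ⟪f, W ω⟫ ^ 4) P := by
    have := (hW.inner_left f).memLp (p := 4) (by simp)
    simpa [Even.pow_abs (show Even 4 by decide)] using this.integrable_norm_pow (p := 4) (by simp)
  have hi2 (f : H) : Integrable (fun ω => ⟪f, W ω⟫ ^ 2) P :=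
    (hW.inner_left f).memLp_two.integrable_sq
  have hi11 : Integrable (fun ω => ⟪f, W ω⟫ * ⟪g, W ω⟫) P :=
    (hW.inner_left f).memLp_two.integrable_mul (hW.inner_left g).memLp_two
  have hadd : ∫ ω, ⟪f + g, W ω⟫ ^ 2 ∂P = ∫ ω, ⟪f, W ω⟫ ^ 2 ∂P +
      2 * (∫ ω, ⟪f, W ω⟫ * ⟪g, W ω⟫ ∂P) + ∫ ω, ⟪g, W ω⟫ ^ 2 ∂P := by
    have h : Integrable (fun ω => ⟪f, W ω⟫ ^ 2 + 2 * (⟪f, W ω⟫ * ⟪g, W ω⟫)) P :=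
      (hi2 f).add (hi11.const_mul 2)
    rw [← integral_const_mul, ← integral_add (hi2 f) (hi11.const_mul 2), ← integral_add h (hi2 g)]
    refine integral_congr_ae (.of_forall fun ω => ?_)
    simp only [inner_add_left]; ring
  have hsub : ∫ ω, ⟪f - g, W ω⟫ ^ 2 ∂P = ∫ ω, ⟪f, W ω⟫ ^ 2 ∂P -
      2 * (∫ ω, ⟪f, W ω⟫ * ⟪g, W ω⟫ ∂P) + ∫ ω, ⟪g, W ω⟫ ^ 2 ∂P := by
    have h : Integrable (fun ω => ⟪f, W ω⟫ ^ 2 - 2 * (⟪f, W ω⟫ * ⟪g, W ω⟫)) P :=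
      (hi2 f).sub (hi11.const_mul 2)
    rw [← integral_const_mul, ← integral_sub (hi2 f) (hi11.const_mul 2), ← integral_add h (hi2 g)]
    refine integral_congr_ae (.of_forall fun ω => ?_)
    simp only [inner_sub_left]; ring
  -- Polarization: 12x²y² = (x+y)⁴ + (x-y)⁴ - 2(x⁴ + y⁴), which reduces the mixed moment to fourth
  -- moments of single Gaussians.
  have key : ∫ ω, ⟪f, W ω⟫ ^ 2 * ⟪g, W ω⟫ ^ 2 ∂P =
      (∫ ω, ⟪f + g, W ω⟫ ^ 4 ∂P + ∫ ω, ⟪f - g, W ω⟫ ^ 4 ∂P -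
        2 * (∫ ω, ⟪f, W ω⟫ ^ 4 ∂P + ∫ ω, ⟪g, W ω⟫ ^ 4 ∂P)) / 12 := by
    have h (f g : H) : Integrable (fun ω => ⟪f, W ω⟫ ^ 4 + ⟪g, W ω⟫ ^ 4) P := (hi f).add (hi g)
    rw [← integral_add (hi f) (hi g), ← integral_add (hi _) (hi _), ← integral_const_mul,
      ← integral_sub (h _ _) ((h _ _).const_mul _), ← integral_div]
    refine integral_congr_ae (.of_forall fun ω => ?_)
    simp only [inner_sub_left, inner_add_left]; ring
  rw [key, hp, hp, hp, hp, hadd, hsub]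
  ring

lemma memLp_two_norm_sq (hW : HasGaussianLaw W P) : MemLp (fun ω => ‖W ω‖ ^ 2) 2 P := by
  have h := hW.memLp (p := 4) (by simp)
  rw [memLp_two_iff_integrable_sq (by have := hW.aemeasurable; fun_prop)]
  have := h.integrable_norm_pow (p := 4) (by simp)
  refine this.congr (.of_forall fun ω => ?_)
  simp only; ring

section HilbertBasis

variable {ι : Type*} [Countable ι] (b : HilbertBasis ι ℝ H) {τ κ : ℝ}

/-- Squaring Parseval gives a double series of nonnegative terms. By Isserlis its expectations split
into a product part summing to τ² and a squared covariance part summing to κ; this summability also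
justifies integrating term by term. -/
lemma integral_norm_pow_four_eq (hW : HasGaussianLaw W P) (h0 : ∫ ω, W ω ∂P = 0)
    (hτ : HasSum (fun i => ∫ ω, ⟪b i, W ω⟫ ^ 2 ∂P) τ)
    (hκ : HasSum (fun p : ι × ι => (∫ ω, ⟪b p.1, W ω⟫ * ⟪b p.2, W ω⟫ ∂P) ^ 2) κ) :
    ∫ ω, (‖W ω‖ ^ 2) ^ 2 ∂P = τ ^ 2 + 2 * κ := by
  have hsum : HasSum (fun p : ι × ι => ∫ ω, ⟪b p.1, W ω⟫ ^ 2 * ⟪b p.2, W ω⟫ ^ 2 ∂P)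
      (τ ^ 2 + 2 * κ) := by
    have hnn (i : ι) : 0 ≤ ∫ ω, ⟪b i, W ω⟫ ^ 2 ∂P := integral_nonneg fun ω => sq_nonneg _
    have := (hτ.mul hτ (hτ.summable.mul_of_nonneg hτ.summable hnn hnn)).add (hκ.mul_left 2)
    rw [← sq] at this
    refine this.congr_fun fun p => ?_
    exact hW.integral_sq_inner_mul_sq_inner h0 _ _
  have hint (p : ι × ι) : Integrable (fun ω => ⟪b p.1, W ω⟫ ^ 2 * ⟪b p.2, W ω⟫ ^ 2) P := by
    have hL (f : H) : MemLp (fun ω => ⟪f, W ω⟫ ^ 2) 2 P :=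
      HasGaussianLaw.memLp_two_norm_sq (hW.inner_left f) |>.congr_norm
        ((hW.inner_left f).aemeasurable.aestronglyMeasurable.pow 2) (by simp)
    exact (hL _).integrable_mul (hL _)
  have h := hasSum_integral_of_summable_integral_norm (μ := P) hint (by
    refine hsum.summable.congr fun p => ?_
    refine integral_congr_ae (.of_forall fun ω => ?_)
    exact (Real.norm_of_nonneg (by positivity)).symm)
  rw [← h.unique hsum]
  refine integral_congr_ae (.of_forall fun ω => ?_)
  have hs := b.hasSum_sq_inner (W ω)
  have := hs.mul hs (hs.summable.mul_of_nonneg hs.summable (fun _ => sq_nonneg _)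
    (fun _ => sq_nonneg _))
  simp only
  rw [this.tsum_eq, sq]

lemma variance_norm_sq_eq (hW : HasGaussianLaw W P) (h0 : ∫ ω, W ω ∂P = 0)
    (hτ : HasSum (fun i => ∫ ω, ⟪b i, W ω⟫ ^ 2 ∂P) τ)
    (hκ : HasSum (fun p : ι × ι => (∫ ω, ⟪b p.1, W ω⟫ * ⟪b p.2, W ω⟫ ∂P) ^ 2) κ) :
    variance (fun ω => ‖W ω‖ ^ 2) P = 2 * κ := by
  have : IsProbabilityMeasure P := hW.isProbabilityMeasure
  rw [variance_eq_sub hW.memLp_two_norm_sq, hW.integral_norm_sq_eq b hτ]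
  have := hW.integral_norm_pow_four_eq b h0 hτ hκ
  simp only [Pi.pow_apply]
  rw [this]; ring

end HilbertBasis

end ProbabilityTheory.HasGaussianLaw

/-- Distinct orthonormal vectors are at distance √2 > 1, so the balls of radius 1/2 around them are
disjoint. -/
lemma Orthonormal.countable {ι H : Type*} [NormedAddCommGroup H] [InnerProductSpace ℝ H]
    [SecondCountableTopology H] {v : ι → H} (hv : Orthonormal ℝ v) : Countable ι := by
  refine Pairwise.countable_of_isOpen_disjoint (s := fun i => Metric.ball (v i) (1 / 2)) ?_
    (fun _ => Metric.isOpen_ball) (fun i => ⟨v i, by simp⟩)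
  intro i j hij
  refine Metric.ball_disjoint_ball ?_
  have h : ‖v i - v j‖ ^ 2 = 2 := by
    rw [norm_sub_sq_real, hv.1 i, hv.1 j, hv.2 hij]; norm_num
  rw [dist_eq_norm]
  nlinarith [norm_nonneg (v i - v j)]

/-! ### Gaussian series and existence of Gaussian elements. -/

open Filter Topology in
/-- An `L¹` limit of centred Gaussian variables with converging variances is Gaussian. -/
lemma ProbabilityTheory.map_eq_gaussianReal_of_tendsto {Ω α : Type*} {mΩ : MeasurableSpace Ω}
    {P : Measure Ω} [IsProbabilityMeasure P] {l : Filter α} [l.NeBot] {Z : α → Ω → ℝ} {Y : Ω → ℝ}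
    {v : α → NNReal} {w : NNReal} (hZ : ∀ a, AEMeasurable (Z a) P) (hY : AEMeasurable Y P)
    (hmap : ∀ a, P.map (Z a) = gaussianReal 0 (v a)) (hv : Tendsto v l (𝓝 w))
    (hi : ∀ a, Integrable (fun ω => Z a ω - Y ω) P)
    (hlim : Tendsto (fun a => ∫ ω, ‖Z a ω - Y ω‖ ∂P) l (𝓝 0)) :
    P.map Y = gaussianReal 0 w := by
  have : IsProbabilityMeasure (P.map Y) := Measure.isProbabilityMeasure_map hY
  refine Measure.ext_of_charFun (funext fun t => ?_)
  have h1 : Tendsto (fun a => charFun (P.map (Z a)) t) l (𝓝 (charFun (gaussianReal 0 w) t)) := by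
    simp only [hmap, charFun_gaussianReal]
    have : Tendsto (fun a => ((v a : ℝ) : ℂ)) l (𝓝 ((w : ℝ) : ℂ)) :=
      (Complex.continuous_ofReal.tendsto _).comp ((NNReal.continuous_coe.tendsto _).comp hv)
    refine (Complex.continuous_exp.tendsto _).comp (tendsto_const_nhds.sub ?_)
    exact (this.mul_const _).div_const _
  refine tendsto_nhds_unique ?_ h1
  rw [tendsto_iff_norm_sub_tendsto_zero]
  have hc {X : Ω → ℝ} (hX : AEMeasurable X P) :
      charFun (P.map X) t = ∫ ω, Complex.exp (Complex.I * ((t * X ω : ℝ) : ℂ)) ∂P := by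
    rw [charFun_apply_real, integral_map hX (by fun_prop)]
    refine integral_congr_ae (.of_forall fun ω => ?_)
    simp only; congr 1; push_cast; ring
  have hint {X : Ω → ℝ} (hX : AEMeasurable X P) :
      Integrable (fun ω => Complex.exp (Complex.I * ((t * X ω : ℝ) : ℂ))) P := by
    refine Integrable.of_bound (C := 1) (by fun_prop) (.of_forall fun ω => ?_)
    rw [mul_comm, Complex.norm_exp_ofReal_mul_I]
  refine squeeze_zero (fun _ => norm_nonneg _) (g := fun a => |t| * ∫ ω, ‖Z a ω - Y ω‖ ∂P)
    (fun a => ?_) (by simpa using hlim.const_mul |t|)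
  rw [hc (hZ a), hc hY, ← integral_sub (hint (hZ a)) (hint hY), ← integral_const_mul]
  refine norm_integral_le_of_norm_le ((hi a).norm.const_mul _) (.of_forall fun ω => ?_)
  -- Factoring out the unimodular exp(itY) leaves exp(it(Z-Y)) - 1, of modulus at most |t| |Z-Y|.
  have key : Complex.exp (Complex.I * ((t * Z a ω : ℝ) : ℂ))
      - Complex.exp (Complex.I * ((t * Y ω : ℝ) : ℂ)) =
      Complex.exp (((t * Y ω : ℝ) : ℂ) * Complex.I) *
        (Complex.exp (Complex.I * ((t * (Z a ω - Y ω) : ℝ) : ℂ)) - 1) := by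
    rw [mul_sub, ← Complex.exp_add, mul_one]
    push_cast
    ring_nf
  rw [key, norm_mul, Complex.norm_exp_ofReal_mul_I, one_mul]
  refine Real.norm_exp_I_mul_ofReal_sub_one_le.trans ?_
  rw [norm_mul, Real.norm_eq_abs]

lemma MeasureTheory.MemLp.smul_const_vec {Ω H : Type*} {mΩ : MeasurableSpace Ω} {P : Measure Ω}
    [NormedAddCommGroup H] [NormedSpace ℝ H] {p : ℝ≥0∞} {ξ : Ω → ℝ} (hξ : MemLp ξ p P) (x : H) :
    MemLp (fun ω => ξ ω • x) p P :=
  (ContinuousLinearMap.toSpanSingleton ℝ x).comp_memLp' hξ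

lemma MeasureTheory.Lp.integral_norm_le_norm {Ω : Type*} {mΩ : MeasurableSpace Ω} {P : Measure Ω}
    [IsProbabilityMeasure P] (g : Lp ℝ 2 P) : ∫ ω, ‖g ω‖ ∂P ≤ ‖g‖ := by
  rw [integral_norm_eq_lintegral_enorm (Lp.aestronglyMeasurable g), Lp.norm_def,
    ← eLpNorm_one_eq_lintegral_enorm]
  exact ENNReal.toReal_mono (Lp.eLpNorm_ne_top g)
    (eLpNorm_le_eLpNorm_of_exponent_le (by norm_num) (Lp.aestronglyMeasurable g))

namespace GaussianSeries

variable {Ω : Type*} {mΩ : MeasurableSpace Ω} {P : Measure Ω}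
  {H : Type*} [NormedAddCommGroup H] [InnerProductSpace ℝ H]

/-- Multiplication of vectors by a fixed random variable of unit second moment, as an isometric
embedding into the space of square integrable random vectors. -/
noncomputable def smulIsometry (ξ : Ω → ℝ) (hξ : MemLp ξ 2 P) (h1 : ∫ ω, ξ ω * ξ ω ∂P = 1) :
    H →ₗᵢ[ℝ] Lp H 2 P :=
  LinearMap.isometryOfInner
    { toFun := fun x => (hξ.smul_const_vec x).toLp (fun ω => ξ ω • x)
      map_add' := fun x y => by
        rw [← MemLp.toLp_add]
        exact MemLp.toLp_congr _ _ (.of_forall fun ω => smul_add _ _ _)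
      map_smul' := fun c x => by
        rw [RingHom.id_apply, ← MemLp.toLp_const_smul]
        exact MemLp.toLp_congr _ _ (.of_forall fun ω => smul_comm _ _ _) }
    fun x y => by
      simp only [LinearMap.coe_mk, AddHom.coe_mk, L2.inner_def]
      rw [← one_mul ⟪x, y⟫, ← h1, ← integral_mul_const]
      refine integral_congr_ae ?_
      filter_upwards [(hξ.smul_const_vec x).coeFn_toLp, (hξ.smul_const_vec y).coeFn_toLp] with ω h h'
      rw [h, h', real_inner_smul_left, real_inner_smul_right, mul_assoc]

lemma coeFn_smulIsometry {ξ : Ω → ℝ} (hξ : MemLp ξ 2 P) (h1 : ∫ ω, ξ ω * ξ ω ∂P = 1) (x : H) :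
    smulIsometry ξ hξ h1 x =ᵐ[P] fun ω => ξ ω • x :=
  (hξ.smul_const_vec x).coeFn_toLp

end GaussianSeries

open GaussianSeries Filter Topology in
/-- A square summable family `h` of vectors of a Hilbert space is the covariance factor of a
centred Gaussian random element. -/
theorem exists_hasGaussianLaw_of_summable {H : Type*} [NormedAddCommGroup H]
    [InnerProductSpace ℝ H] [CompleteSpace H] [SecondCountableTopology H] [MeasurableSpace H]
    [BorelSpace H] {κ : Type} {h : κ → H} (hh : Summable fun k => ‖h k‖ ^ 2) :
    ∃ (Ω : Type) (_ : MeasurableSpace Ω) (P : Measure Ω) (_ : IsProbabilityMeasure P)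
      (W : Ω → H), HasGaussianLaw W P ∧ ∫ ω, W ω ∂P = 0 ∧
      ∀ f g, HasSum (fun k => ⟪f, h k⟫ * ⟪g, h k⟫) (∫ ω, ⟪f, W ω⟫ * ⟪g, W ω⟫ ∂P) := by
  classical
  obtain ⟨Ω, mΩ, P, ξ, hmeas, hlaw, hind, hP⟩ := exists_iid κ (gaussianReal 0 1)
  have hG (i : κ) : HasGaussianLaw (ξ i) P := (hlaw i).hasGaussianLaw
  have hL (i : κ) : MemLp (ξ i) 2 P := (hG i).memLp_two
  have hmean (i : κ) : ∫ ω, ξ i ω ∂P = 0 := by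
    rw [(hlaw i).integral_eq]; simp
  have hone (i : κ) : ∫ ω, ξ i ω * ξ i ω ∂P = 1 := by
    have := variance_of_integral_eq_zero (hmeas i).aemeasurable (hmean i)
    rw [(hlaw i).variance_eq, variance_id_gaussianReal] at this
    simp only [← sq, ← this, NNReal.coe_one]
  have hcross {i j : κ} (hij : i ≠ j) : ∫ ω, ξ i ω * ξ j ω ∂P = 0 := by
    rw [(hind.indepFun hij).integral_fun_mul_eq_mul_integral (hL i).1 (hL j).1, hmean, zero_mul]
  let V (i : κ) : H →ₗᵢ[ℝ] Lp H 2 P := smulIsometry (ξ i) (hL i) (hone i)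
  -- The ξ_i are uncorrelated, so the summands ξ_i h_i are orthogonal in L²(Ω; H) and their series
  -- converges as soon as Σ‖h_i‖² does.
  have hV : OrthogonalFamily ℝ (fun _ : κ => H) V := by
    intro i j hij x y
    rw [L2.inner_def, ← zero_mul ⟪x, y⟫, ← hcross hij, ← integral_mul_const]
    refine integral_congr_ae ?_
    filter_upwards [coeFn_smulIsometry (hL i) (hone i) x, coeFn_smulIsometry (hL j) (hone j) y]
      with ω h h'
    rw [h, h', real_inner_smul_left, real_inner_smul_right, mul_assoc]
  obtain ⟨S, hS⟩ : Summable fun i => V i (h i) := (hV.summable_iff_norm_sq_summable h).2 hh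
  let u (i : κ) : Lp ℝ 2 P := (hL i).toLp (ξ i)
  have huu (i j : κ) : ⟪u i, u j⟫ = ∫ ω, ξ i ω * ξ j ω ∂P := by
    rw [L2.inner_def]
    refine integral_congr_ae ?_
    filter_upwards [(hL i).coeFn_toLp, (hL j).coeFn_toLp] with ω h h'
    simp [u, h, h', mul_comm]
  -- Pairing pointwise with f is continuous from L²(Ω; H) to L²(Ω), so it carries the vector series
  -- to the scalar series Σ⟪f, h_i⟫ ξ_i.
  let L (f : H) : Lp H 2 P →L[ℝ] Lp ℝ 2 P := (innerSL ℝ f).compLpL 2 P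
  have hLS (f : H) : L f S =ᵐ[P] fun ω => ⟪f, S ω⟫ := (innerSL ℝ f).coeFn_compLpL S
  have hLV (f : H) (i : κ) : L f (V i (h i)) = ⟪f, h i⟫ • u i := by
    refine Lp.ext ?_
    filter_upwards [(innerSL ℝ f).coeFn_compLpL (V i (h i)), Lp.coeFn_smul ⟪f, h i⟫ (u i),
      (hL i).coeFn_toLp, coeFn_smulIsometry (hL i) (hone i) (h i)] with ω h1 h2 h3 h4
    rw [h1, h2, h4]
    simp [u, h3, mul_comm]
  have hX (f : H) : HasSum (fun i => ⟪f, h i⟫ • u i) (L f S) := by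
    simpa only [hLV] using hS.mapL (L f)
  have hinner (f g : H) : ⟪L f S, L g S⟫ = ∫ ω, ⟪f, S ω⟫ * ⟪g, S ω⟫ ∂P := by
    rw [L2.inner_def]
    refine integral_congr_ae ?_
    filter_upwards [hLS f, hLS g] with ω h1 h2
    simp [h1, h2, mul_comm]
  have hcoord (g : H) (i : κ) : ⟪u i, L g S⟫ = ⟪g, h i⟫ := by
    have h1 := (hX g).mapL (innerSL ℝ (u i))
    simp only [innerSL_apply_apply, real_inner_smul_right, huu] at h1
    refine h1.unique ?_
    have := hasSum_single (f := fun j => ⟪g, h j⟫ * ∫ ω, ξ i ω * ξ j ω ∂P) i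
      (fun j hj => by rw [hcross hj.symm, mul_zero])
    simpa [hone] using this
  have hint (f : H) : ∫ ω, L f S ω ∂P = 0 := by
    let e : Lp ℝ 2 P := (memLp_const (1 : ℝ)).toLp _
    have he (g : Lp ℝ 2 P) : ⟪e, g⟫ = ∫ ω, g ω ∂P := by
      rw [L2.inner_def]
      refine integral_congr_ae ?_
      filter_upwards [(memLp_const (μ := P) (p := 2) (1 : ℝ)).coeFn_toLp] with ω h
      rw [h]
      simp
    have h1 := (hX f).mapL (innerSL ℝ e)
    have h2 (i : κ) : ∫ ω, u i ω ∂P = 0 := by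
      rw [← hmean i]; exact integral_congr_ae (hL i).coeFn_toLp
    simp only [innerSL_apply_apply, real_inner_smul_right] at h1
    simp only [he, h2, mul_zero] at h1
    exact h1.unique hasSum_zero
  have hSmeas : AEMeasurable S P := (Lp.stronglyMeasurable S).measurable.aemeasurable
  refine ⟨Ω, mΩ, P, hP, S, ⟨isGaussian_of_map_eq_gaussianReal fun l => ?_⟩, ?_, fun f g => ?_⟩
  · obtain ⟨f, rfl⟩ := (InnerProductSpace.toDual ℝ H).surjective l
    rw [AEMeasurable.map_map_of_aemeasurable (by fun_prop) hSmeas]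
    refine ⟨0, (‖L f S‖ ^ 2).toNNReal, ?_⟩
    have : P.map (⇑(InnerProductSpace.toDual ℝ H f) ∘ S) = P.map (L f S) :=
      Measure.map_congr (hLS f).symm
    rw [this]
    -- Finite partial sums are Gaussian by independence; they converge in L², hence in L¹, and their
    -- variances are their squared norms.
    let A (F : Finset κ) : Lp ℝ 2 P := ∑ i ∈ F, ⟪f, h i⟫ • u i
    have hA : Tendsto A atTop (𝓝 (L f S)) := hX f
    have hAm (g : Lp ℝ 2 P) : AEMeasurable g P := (Lp.stronglyMeasurable g).measurable.aemeasurable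
    have hsq (g : Lp ℝ 2 P) : ∫ ω, g ω ^ 2 ∂P = ‖g‖ ^ 2 := by
      rw [← real_inner_self_eq_norm_sq, L2.inner_def]
      simp [sq]
    have hsub (F : Finset κ) : ⇑(A F - L f S) =ᵐ[P] fun ω => A F ω - L f S ω := Lp.coeFn_sub _ _
    have hAG (F : Finset κ) : P.map (A F) = gaussianReal 0 (‖A F‖ ^ 2).toNNReal := by
      have hAe : (fun ω => ∑ i : F, ⟪f, h i⟫ * ξ i ω) =ᵐ[P] A F := by
        have h1 : ∀ᵐ ω ∂P, ∀ i : F, (⟪f, h i⟫ • u i : Lp ℝ 2 P) ω = ⟪f, h i⟫ * ξ i ω := by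
          rw [ae_all_iff]
          intro i
          filter_upwards [Lp.coeFn_smul ⟪f, h i⟫ (u i), (hL i).coeFn_toLp] with ω h1 h2
          rw [h1, Pi.smul_apply, h2, smul_eq_mul]
        filter_upwards [h1, Lp.coeFn_finsetSum F (fun i => ⟪f, h i⟫ • u i)] with ω h1 h2
        rw [show A F ω = _ from h2, Finset.sum_apply, ← Finset.sum_coe_sort F]
        exact Finset.sum_congr rfl fun i _ => (h1 i).symm
      have hg : HasGaussianLaw (A F) P := by
        have h1 : HasGaussianLaw (fun ω (i : F) => ξ i ω) P :=
          iIndepFun.hasGaussianLaw (fun i => hG i) (hind.precomp Subtype.val_injective)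
        have h2 := h1.map_fun (∑ i : F, ⟪f, h i⟫ • ContinuousLinearMap.proj (R := ℝ)
          (φ := fun _ : F => ℝ) i)
        simp only [FunLike.coe_sum, Finset.sum_apply,
          FunLike.coe_smul, Pi.smul_apply, ContinuousLinearMap.proj_apply,
          smul_eq_mul] at h2
        exact h2.congr hAe
      have hz : ∫ ω, A F ω ∂P = 0 := by
        rw [← integral_congr_ae hAe, integral_finsetSum _
          (fun i _ => ((hL i.1).integrable (by norm_num)).const_mul _)]
        simp [integral_const_mul, hmean]
      rw [hg.map_eq_gaussianReal, hz, variance_of_integral_eq_zero (hAm _) hz, hsq]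
    refine map_eq_gaussianReal_of_tendsto (l := atTop) (Z := fun F => A F) (fun F => hAm _)
      (hAm _) hAG ?_ (fun F => ?_) ?_
    · exact (continuous_real_toNNReal.tendsto _).comp (hA.norm.pow 2)
    · exact ((Lp.memLp (A F)).sub (Lp.memLp (L f S))).integrable (by norm_num)
    · refine squeeze_zero (fun F => integral_nonneg fun _ => norm_nonneg _) (fun F => ?_)
        (tendsto_iff_norm_sub_tendsto_zero.1 hA)
      refine le_trans (le_of_eq ?_) (Lp.integral_norm_le_norm (A F - L f S))
      refine integral_congr_ae ?_
      filter_upwards [hsub F] with ω hω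
      rw [hω]
  · refine integral_eq_zero_of_forall_integral_inner_eq_zero ℝ _
      ((Lp.memLp S).integrable (by norm_num)) fun f => ?_
    rw [← integral_congr_ae (hLS f), hint]
  · have h1 := (hX f).mapL (innerSL ℝ (L g S))
    simp only [innerSL_apply_apply, real_inner_smul_right] at h1
    rw [real_inner_comm, hinner] at h1
    refine h1.congr_fun fun i => ?_
    rw [real_inner_comm (u i), hcoord]

/-! ### Gaussian integrals against the weight. -/

section WeightMeasure

variable {d : ℕ}

instance (β : ℝ) : SFinite (weightMeasure d β) := by
  unfold weightMeasure; infer_instance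

lemma integral_weightMeasure (β : ℝ) (f : EuclideanSpace ℝ (Fin d) → ℝ) :
    ∫ t, f t ∂(weightMeasure d β) = ∫ t, Real.exp (-β * ‖t‖ ^ 2) * f t := by
  unfold weightMeasure
  rw [integral_withDensity_eq_integral_toReal_smul (by fun_prop) (by simp)]
  simp [Real.exp_nonneg]

lemma integrable_weightMeasure_iff (β : ℝ) {f : EuclideanSpace ℝ (Fin d) → ℝ} :
    Integrable f (weightMeasure d β) ↔
      Integrable fun t => Real.exp (-β * ‖t‖ ^ 2) * f t := by
  unfold weightMeasure
  rw [integrable_withDensity_iff_integrable_smul' (by fun_prop) (by simp)]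
  simp [Real.exp_nonneg]

lemma integral_exp_mul_weightMeasure (β k : ℝ) (f : EuclideanSpace ℝ (Fin d) → ℝ) :
    ∫ t, Real.exp (k * ‖t‖ ^ 2) * f t ∂(weightMeasure d β) =
      ∫ t, f t ∂(weightMeasure d (β - k)) := by
  rw [integral_weightMeasure, integral_weightMeasure]
  congr 1 with t
  rw [← mul_assoc, ← Real.exp_add]
  ring_nf

lemma integrable_exp_mul_weightMeasure_iff (β k : ℝ) {f : EuclideanSpace ℝ (Fin d) → ℝ} :
    Integrable (fun t => Real.exp (k * ‖t‖ ^ 2) * f t) (weightMeasure d β) ↔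
      Integrable f (weightMeasure d (β - k)) := by
  rw [integrable_weightMeasure_iff, integrable_weightMeasure_iff]
  refine iff_of_eq (congrArg (Integrable · volume) (funext fun t => ?_))
  rw [← mul_assoc, ← Real.exp_add]
  ring_nf

lemma integrable_exp_neg_mul_sq_norm_add {b : ℝ} (hb : 0 < b) (c : ℝ)
    (w : EuclideanSpace ℝ (Fin d)) :
    Integrable fun v : EuclideanSpace ℝ (Fin d) => Real.exp (-b * ‖v‖ ^ 2 + c * ⟪w, v⟫) := by
  have := (GaussianFourier.integrable_cexp_neg_mul_sq_norm_add (b := (b : ℂ)) (by simpa) c w).re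
  refine this.congr (.of_forall fun v => ?_)
  simp only [RCLike.re_eq_complex_re]
  rw [← Complex.exp_ofReal_re]
  push_cast
  rfl

lemma integral_exp_neg_mul_sq_norm_add {b : ℝ} (hb : 0 < b) (c : ℝ)
    (w : EuclideanSpace ℝ (Fin d)) :
    ∫ v : EuclideanSpace ℝ (Fin d), Real.exp (-b * ‖v‖ ^ 2 + c * ⟪w, v⟫) =
      (Real.pi / b) ^ ((d : ℝ) / 2) * Real.exp (c ^ 2 * ‖w‖ ^ 2 / (4 * b)) := by
  have h := GaussianFourier.integral_cexp_neg_mul_sq_norm_add (b := (b : ℂ)) (by simpa) c w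
  rw [← Complex.ofReal_inj, ← integral_complex_ofReal]
  push_cast
  rw [h, Complex.ofReal_cpow (by positivity)]
  simp

lemma integrable_exp_mul_inner_weightMeasure {b : ℝ} (hb : 0 < b) (c : ℝ)
    (w : EuclideanSpace ℝ (Fin d)) :
    Integrable (fun v => Real.exp (c * ⟪w, v⟫)) (weightMeasure d b) := by
  rw [integrable_weightMeasure_iff]
  simpa only [Real.exp_add] using integrable_exp_neg_mul_sq_norm_add hb c w

lemma integral_exp_mul_inner_weightMeasure {b : ℝ} (hb : 0 < b) (c : ℝ)
    (w : EuclideanSpace ℝ (Fin d)) :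
    ∫ v, Real.exp (c * ⟪w, v⟫) ∂(weightMeasure d b) =
      (Real.pi / b) ^ ((d : ℝ) / 2) * Real.exp (c ^ 2 * ‖w‖ ^ 2 / (4 * b)) := by
  rw [integral_weightMeasure, ← integral_exp_neg_mul_sq_norm_add hb]
  simp only [Real.exp_add]

lemma integrable_exp_mul_sq_norm {b c : ℝ} (hc : c < b) :
    Integrable (fun v => Real.exp (c * ‖v‖ ^ 2)) (weightMeasure d b) := by
  have h := integrable_exp_mul_inner_weightMeasure (d := d) (sub_pos.2 hc) 0 0
  rw [← integrable_exp_mul_weightMeasure_iff] at h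
  simpa using h

lemma integral_exp_mul_sq_norm {b c : ℝ} (hc : c < b) :
    ∫ v, Real.exp (c * ‖v‖ ^ 2) ∂(weightMeasure d b) = (Real.pi / (b - c)) ^ ((d : ℝ) / 2) := by
  have h := integral_exp_mul_inner_weightMeasure (d := d) (sub_pos.2 hc) 0 0
  rw [← integral_exp_mul_weightMeasure] at h
  simpa using h

/-! ### Tilted moments of the squared norm. -/

section NormMoments

variable {b c : ℝ}

lemma mem_interior_integrableExpSet_sq_norm (hc : c < b) :
    c ∈ interior (integrableExpSet (fun v => ‖v‖ ^ 2) (weightMeasure d b)) :=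
  interior_maximal (fun _ h => integrable_exp_mul_sq_norm h) isOpen_Iio (Set.mem_Iio.2 hc)

/-- The new exponent is a separate variable so that repeated differentiation keeps exponents in the
form -d/2 - k. -/
lemma hasDerivAt_sub_rpow {r r' : ℝ} (hr : r' = r - 1) (hc : c < b) :
    HasDerivAt (fun c => (b - c) ^ r) (-r * (b - c) ^ r') c := by
  subst hr
  exact (((hasDerivAt_id c).const_sub b).rpow_const (Or.inl (sub_pos.2 hc).ne')).congr_deriv
    (by simp)

lemma integral_exp_sq_norm_eq (hc : c < b) :
    ∫ v, (‖v‖ ^ 2) ^ 0 * Real.exp (c * ‖v‖ ^ 2) ∂(weightMeasure d b) =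
      Real.pi ^ ((d : ℝ) / 2) * (b - c) ^ (-((d : ℝ) / 2)) := by
  simp only [pow_zero, one_mul]
  rw [integral_exp_mul_sq_norm hc, Real.div_rpow Real.pi_pos.le (sub_pos.2 hc).le,
    Real.rpow_neg (sub_pos.2 hc).le, div_eq_mul_inv]

lemma integral_sq_norm_mul_exp (hc : c < b) :
    ∫ v, (‖v‖ ^ 2) ^ 1 * Real.exp (c * ‖v‖ ^ 2) ∂(weightMeasure d b) =
      Real.pi ^ ((d : ℝ) / 2) * ((d : ℝ) / 2 * (b - c) ^ (-((d : ℝ) / 2) - 1)) :=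
  (hasDerivAt_integral_pow_mul_exp_real (mem_interior_integrableExpSet_sq_norm hc) 0).eq_of_eqOn
    isOpen_Iio (fun _ h => integral_exp_sq_norm_eq h) hc
    (((hasDerivAt_sub_rpow rfl hc).const_mul _).congr_deriv (by ring))

lemma integral_sq_norm_sq_mul_exp (hc : c < b) :
    ∫ v, (‖v‖ ^ 2) ^ 2 * Real.exp (c * ‖v‖ ^ 2) ∂(weightMeasure d b) =
      Real.pi ^ ((d : ℝ) / 2) *
        ((d : ℝ) / 2 * ((d : ℝ) / 2 + 1) * (b - c) ^ (-((d : ℝ) / 2) - 2)) :=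
  (hasDerivAt_integral_pow_mul_exp_real (mem_interior_integrableExpSet_sq_norm hc) 1).eq_of_eqOn
    isOpen_Iio (fun _ h => integral_sq_norm_mul_exp h) hc
    ((((hasDerivAt_sub_rpow (r' := -((d : ℝ) / 2) - 2) (by ring) hc).const_mul _).const_mul
      _).congr_deriv (by ring))

lemma integrable_sq_norm_pow_mul_exp (hc : c < b) (n : ℕ) :
    Integrable (fun v => (‖v‖ ^ 2) ^ n * Real.exp (c * ‖v‖ ^ 2)) (weightMeasure d b) :=
  integrable_pow_mul_exp_of_mem_interior_integrableExpSet
    (mem_interior_integrableExpSet_sq_norm hc) n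

end NormMoments

/-! ### Tilted moments of the inner product of two variables. -/

section InnerMoments

variable {a c : ℝ}

/-- The product of two copies of the weight measure. -/
noncomputable abbrev weightProd (d : ℕ) (a : ℝ) :
    Measure (EuclideanSpace ℝ (Fin d) × EuclideanSpace ℝ (Fin d)) :=
  (weightMeasure d a).prod (weightMeasure d a)

/-- Cauchy–Schwarz and 2xy ≤ x² + y² separate the variables, so the tilted exponential is dominated
by a product integrable when |c|/2 < a. -/
lemma mul_inner_le_norm_sq (c : ℝ) (s t : EuclideanSpace ℝ (Fin d)) :
    c * ⟪s, t⟫ ≤ |c| / 2 * ‖s‖ ^ 2 + |c| / 2 * ‖t‖ ^ 2 := by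
  have h1 : c * ⟪s, t⟫ ≤ |c| * (‖s‖ * ‖t‖) :=
    (le_abs_self _).trans ((abs_mul _ _).trans_le
      (mul_le_mul_of_nonneg_left (abs_real_inner_le_norm s t) (abs_nonneg c)))
  nlinarith [mul_nonneg (abs_nonneg c) (sq_nonneg (‖s‖ - ‖t‖))]

lemma integrable_exp_mul_inner (hc : |c| < 2 * a) :
    Integrable (fun p : EuclideanSpace ℝ (Fin d) × EuclideanSpace ℝ (Fin d) =>
      Real.exp (c * ⟪p.1, p.2⟫)) (weightProd d a) := by
  have h := integrable_exp_mul_sq_norm (d := d) (b := a) (c := |c| / 2) (by linarith)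
  refine (h.mul_prod h).mono' (by fun_prop) (.of_forall fun p => ?_)
  rw [Real.norm_of_nonneg (Real.exp_nonneg _), ← Real.exp_add]
  exact Real.exp_le_exp.2 (mul_inner_le_norm_sq c p.1 p.2)

lemma sub_sq_div_four_pos (hc : |c| < 2 * a) : 0 < a ^ 2 - c ^ 2 / 4 := by
  have := abs_lt.1 hc
  nlinarith

lemma isOpen_abs_lt : IsOpen {c : ℝ | |c| < 2 * a} := isOpen_lt continuous_abs continuous_const

lemma mem_interior_integrableExpSet_inner (hc : |c| < 2 * a) :
    c ∈ interior (integrableExpSet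
      (fun p : EuclideanSpace ℝ (Fin d) × EuclideanSpace ℝ (Fin d) => ⟪p.1, p.2⟫)
      (weightProd d a)) :=
  interior_maximal (fun _ h => integrable_exp_mul_inner h) isOpen_abs_lt hc

lemma hasDerivAt_sub_sq_rpow {r r' : ℝ} (hr : r' = r - 1) (hc : |c| < 2 * a) :
    HasDerivAt (fun c => (a ^ 2 - c ^ 2 / 4) ^ r) (-(r * c / 2) * (a ^ 2 - c ^ 2 / 4) ^ r') c := by
  subst hr
  refine (((((hasDerivAt_id c).pow 2).div_const 4).const_sub (a ^ 2)).rpow_const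
    (Or.inl (sub_sq_div_four_pos hc).ne')).congr_deriv ?_
  simp only [id, Pi.pow_apply]
  push_cast
  ring

/-- Integrating out one variable leaves exp(c²‖s‖²/(4a)), another Gaussian integral; the two
constants combine through a(a - c²/(4a)) = a² - c²/4. -/
lemma integral_exp_inner_eq (hc : |c| < 2 * a) :
    ∫ p, ⟪p.1, p.2⟫ ^ 0 * Real.exp (c * ⟪p.1, p.2⟫) ∂(weightProd d a) =
      Real.pi ^ d * (a ^ 2 - c ^ 2 / 4) ^ (-((d : ℝ) / 2)) := by
  have ha : 0 < a := by have := (abs_nonneg c).trans_lt hc; linarith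
  have hpos := sub_sq_div_four_pos hc
  simp only [pow_zero, one_mul]
  rw [integral_prod _ (integrable_exp_mul_inner hc)]
  simp only [integral_exp_mul_inner_weightMeasure ha]
  have h1 : c ^ 2 / (4 * a) < a := by
    rw [div_lt_iff₀ (by positivity)]; nlinarith
  have h2 := integral_exp_mul_sq_norm (d := d) h1
  have h3 : ∀ x : EuclideanSpace ℝ (Fin d),
      c ^ 2 * ‖x‖ ^ 2 / (4 * a) = c ^ 2 / (4 * a) * ‖x‖ ^ 2 := fun x => by ring
  simp only [h3]
  rw [integral_const_mul, h2, ← Real.mul_rpow (by positivity)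
    (div_nonneg Real.pi_pos.le (sub_pos.2 h1).le)]
  have h4 : Real.pi / a * (Real.pi / (a - c ^ 2 / (4 * a))) =
      Real.pi ^ 2 / (a ^ 2 - c ^ 2 / 4) := by
    rw [div_mul_div_comm]; congr 1
    · ring
    · field_simp
  rw [h4, Real.div_rpow (by positivity) hpos.le, Real.rpow_neg hpos.le, div_eq_mul_inv]
  congr 1
  rw [← Real.rpow_natCast, ← Real.rpow_natCast, ← Real.rpow_mul Real.pi_pos.le]
  congr 1
  push_cast
  ring

lemma integral_inner_mul_exp (hc : |c| < 2 * a) :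
    ∫ p, ⟪p.1, p.2⟫ ^ 1 * Real.exp (c * ⟪p.1, p.2⟫) ∂(weightProd d a) =
      Real.pi ^ d * ((d : ℝ) / 4 * c * (a ^ 2 - c ^ 2 / 4) ^ (-((d : ℝ) / 2) - 1)) :=
  (hasDerivAt_integral_pow_mul_exp_real (mem_interior_integrableExpSet_inner hc) 0).eq_of_eqOn
    isOpen_abs_lt (fun _ h => integral_exp_inner_eq h) hc
    (((hasDerivAt_sub_sq_rpow rfl hc).const_mul _).congr_deriv (by ring))

lemma integral_inner_pow_two_mul_exp (hc : |c| < 2 * a) :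
    ∫ p, ⟪p.1, p.2⟫ ^ 2 * Real.exp (c * ⟪p.1, p.2⟫) ∂(weightProd d a) =
      Real.pi ^ d * ((d : ℝ) / 4 * (a ^ 2 - c ^ 2 / 4) ^ (-((d : ℝ) / 2) - 1) +
        (d : ℝ) * (d + 2) / 16 * c ^ 2 * (a ^ 2 - c ^ 2 / 4) ^ (-((d : ℝ) / 2) - 2)) :=
  (hasDerivAt_integral_pow_mul_exp_real (mem_interior_integrableExpSet_inner hc) 1).eq_of_eqOn
    isOpen_abs_lt (fun _ h => integral_inner_mul_exp h) hc
    (((((hasDerivAt_id c).const_mul ((d : ℝ) / 4)).mul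
      (hasDerivAt_sub_sq_rpow (r' := -((d : ℝ) / 2) - 2) (by ring) hc)).const_mul
      _).congr_deriv (by simp only [id]; ring))

lemma integral_inner_pow_three_mul_exp (hc : |c| < 2 * a) :
    ∫ p, ⟪p.1, p.2⟫ ^ 3 * Real.exp (c * ⟪p.1, p.2⟫) ∂(weightProd d a) =
      Real.pi ^ d * (3 * (d : ℝ) * (d + 2) / 16 * c *
          (a ^ 2 - c ^ 2 / 4) ^ (-((d : ℝ) / 2) - 2) +
        (d : ℝ) * (d + 2) * (d + 4) / 64 * c ^ 3 *
          (a ^ 2 - c ^ 2 / 4) ^ (-((d : ℝ) / 2) - 3)) :=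
  (hasDerivAt_integral_pow_mul_exp_real (mem_interior_integrableExpSet_inner hc) 2).eq_of_eqOn
    isOpen_abs_lt (fun _ h => integral_inner_pow_two_mul_exp h) hc
    ((((hasDerivAt_sub_sq_rpow (r' := -((d : ℝ) / 2) - 2) (by ring) hc).const_mul
      ((d : ℝ) / 4)).add
      ((((hasDerivAt_id c).pow 2).const_mul ((d : ℝ) * (d + 2) / 16)).mul
      (hasDerivAt_sub_sq_rpow (r' := -((d : ℝ) / 2) - 3) (by ring) hc))).const_mul
      _ |>.congr_deriv (by simp; ring))

lemma integral_inner_pow_four (ha : 0 < a) :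
    ∫ p, ⟪p.1, p.2⟫ ^ 4 * Real.exp (0 * ⟪p.1, p.2⟫) ∂(weightProd d a) =
      Real.pi ^ d * (3 * (d : ℝ) * (d + 2) / 16 * (a ^ 2) ^ (-((d : ℝ) / 2) - 2)) :=
  have hc : |(0 : ℝ)| < 2 * a := by simpa using ha
  (hasDerivAt_integral_pow_mul_exp_real (mem_interior_integrableExpSet_inner hc) 3).eq_of_eqOn
    isOpen_abs_lt (fun _ h => integral_inner_pow_three_mul_exp h) hc
    (((((hasDerivAt_id (0 : ℝ)).const_mul (3 * (d : ℝ) * (d + 2) / 16)).mul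
      (hasDerivAt_sub_sq_rpow (r' := -((d : ℝ) / 2) - 3) (by ring) hc)).add
      ((((hasDerivAt_id (0 : ℝ)).pow 3).const_mul ((d : ℝ) * (d + 2) * (d + 4) / 64)).mul
      (hasDerivAt_sub_sq_rpow (r' := -((d : ℝ) / 2) - 4) (by ring) hc))).const_mul
      _ |>.congr_deriv (by simp))

lemma integrable_inner_pow_mul_exp (hc : |c| < 2 * a) (n : ℕ) :
    Integrable (fun p => ⟪p.1, p.2⟫ ^ n * Real.exp (c * ⟪p.1, p.2⟫)) (weightProd d a) :=
  integrable_pow_mul_exp_of_mem_interior_integrableExpSet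
    (mem_interior_integrableExpSet_inner hc) n

end InnerMoments

end WeightMeasure

/-! ### Closed forms for the trace and the Hilbert–Schmidt norm. -/

section KernelIntegrals

variable {d : ℕ} {β : ℝ}

lemma continuous_limitKernel :
    Continuous fun p : EuclideanSpace ℝ (Fin d) × EuclideanSpace ℝ (Fin d) =>
      limitKernel p.1 p.2 := by
  unfold limitKernel; fun_prop

lemma limitKernel_self (t : EuclideanSpace ℝ (Fin d)) :
    limitKernel t t = (‖t‖ ^ 2) ^ 0 * Real.exp (2 * ‖t‖ ^ 2) - (‖t‖ ^ 2) ^ 0 * Real.exp (1 * ‖t‖ ^ 2)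
      - (‖t‖ ^ 2) ^ 1 * Real.exp (1 * ‖t‖ ^ 2)
      - 1 / 2 * ((‖t‖ ^ 2) ^ 2 * Real.exp (1 * ‖t‖ ^ 2)) := by
  have : Real.exp (2 * ‖t‖ ^ 2) = Real.exp (‖t‖ ^ 2) * Real.exp (‖t‖ ^ 2) := by
    rw [← Real.exp_add]; ring_nf
  rw [this]
  unfold limitKernel
  rw [real_inner_self_eq_norm_sq, add_self_div_two]
  ring_nf

lemma integrable_limitKernel_self (hβ : 2 < β) :
    Integrable (fun t => limitKernel t t) (weightMeasure d β) := by
  simp only [limitKernel_self]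
  have h1 : 1 < β := by linarith
  exact (((integrable_sq_norm_pow_mul_exp hβ 0).sub (integrable_sq_norm_pow_mul_exp h1 0)).sub
    (integrable_sq_norm_pow_mul_exp h1 1)).sub ((integrable_sq_norm_pow_mul_exp h1 2).const_mul _)

lemma Real.rpow_neg_sub_eq_one_div {x : ℝ} (hx : 0 < x) (u v : ℝ) :
    x ^ (-u - v) = 1 / x ^ (u + v) := by
  rw [← neg_add', Real.rpow_neg hx.le, one_div]

lemma integral_limitKernel_self (hβ : 2 < β) :
    ∫ t, limitKernel t t ∂(weightMeasure d β) = Real.pi ^ ((d : ℝ) / 2) *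
      (1 / (β - 2) ^ ((d : ℝ) / 2) - 1 / (β - 1) ^ ((d : ℝ) / 2)
        - d / (2 * (β - 1) ^ ((d : ℝ) / 2 + 1))
        - d * (d + 2) / (8 * (β - 1) ^ ((d : ℝ) / 2 + 2))) := by
  have h1 : 1 < β := by linarith
  have i (n : ℕ) := integrable_sq_norm_pow_mul_exp (d := d) h1 n
  have j := integrable_sq_norm_pow_mul_exp (d := d) hβ 0
  simp only [limitKernel_self]
  have k1 : Integrable (fun t => (‖t‖ ^ 2) ^ 0 * Real.exp (2 * ‖t‖ ^ 2)
      - (‖t‖ ^ 2) ^ 0 * Real.exp (1 * ‖t‖ ^ 2)) (weightMeasure d β) := j.sub (i 0)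
  have k2 : Integrable (fun t => (‖t‖ ^ 2) ^ 0 * Real.exp (2 * ‖t‖ ^ 2)
      - (‖t‖ ^ 2) ^ 0 * Real.exp (1 * ‖t‖ ^ 2)
      - (‖t‖ ^ 2) ^ 1 * Real.exp (1 * ‖t‖ ^ 2)) (weightMeasure d β) := k1.sub (i 1)
  rw [integral_sub k2 ((i 2).const_mul _), integral_sub k1 (i 1),
    integral_sub j (i 0), integral_const_mul, integral_exp_sq_norm_eq hβ,
    integral_exp_sq_norm_eq h1, integral_sq_norm_mul_exp h1, integral_sq_norm_sq_mul_exp h1,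
    Real.rpow_neg_sub_eq_one_div (sub_pos.2 h1), Real.rpow_neg_sub_eq_one_div (sub_pos.2 h1),
    Real.rpow_neg (sub_pos.2 h1).le, Real.rpow_neg (sub_pos.2 hβ).le]
  field_simp
  ring

/-- At c = 1 the base is η/4; the powers 2^d in the variance come from 4^(d/2). -/
lemma div_four_rpow {x : ℝ} (hx : 0 < x) (k : ℕ) :
    (x / 4) ^ (-((d : ℝ) / 2) - k) = 2 ^ d * 4 ^ k / x ^ ((d : ℝ) / 2 + k) := by
  rw [Real.rpow_neg_sub_eq_one_div (by positivity), Real.div_rpow hx.le (by norm_num), one_div_div,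
    Real.rpow_add (by norm_num) ((d : ℝ) / 2), Real.rpow_natCast]
  congr 2
  rw [show (4 : ℝ) = 2 ^ (2 : ℝ) by norm_num, ← Real.rpow_mul (by norm_num),
    mul_div_cancel₀ _ (by norm_num), Real.rpow_natCast]

lemma sq_rpow {x : ℝ} (hx : 0 < x) (k : ℕ) :
    (x ^ 2) ^ (-((d : ℝ) / 2) - k) = 1 / x ^ (d + 2 * k) := by
  rw [Real.rpow_neg_sub_eq_one_div (by positivity), ← Real.rpow_natCast x 2, ← Real.rpow_mul hx.le,
    ← Real.rpow_natCast x]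
  congr 2
  push_cast
  ring

/-- The sum of the exponential series without its terms of degree at most two. -/
noncomputable def expTail (x : ℝ) : ℝ := Real.exp x - 1 - x - x ^ 2 / 2

lemma limitKernel_sq (s t : EuclideanSpace ℝ (Fin d)) :
    limitKernel s t ^ 2 =
      Real.exp (1 * ‖s‖ ^ 2) * (Real.exp (1 * ‖t‖ ^ 2) * expTail ⟪s, t⟫ ^ 2) := by
  unfold limitKernel
  change (_ * expTail ⟪s, t⟫) ^ 2 = _
  rw [mul_pow, ← Real.exp_nat_mul, ← mul_assoc, ← Real.exp_add]
  congr 2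
  push_cast
  ring

/-- The square of `expTail` as a combination of the functions `x ^ n * exp (c * x)`. -/
lemma expTail_sq (x : ℝ) :
    expTail x ^ 2 = ∑ i : Fin 9, (![1, -2, -2, -1, 1, 2, 2, 1, 1 / 4] : Fin 9 → ℝ) i *
      (x ^ (![0, 0, 1, 2, 0, 1, 2, 3, 4] : Fin 9 → ℕ) i *
        Real.exp ((![2, 1, 1, 1, 0, 0, 0, 0, 0] : Fin 9 → ℝ) i * x)) := by
  have : Real.exp (2 * x) = Real.exp x * Real.exp x := by rw [← Real.exp_add]; ring_nf
  simp [Fin.sum_univ_succ, expTail, this]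
  ring

lemma abs_expTail_exponent_lt {a : ℝ} (ha : 1 < a) (i : Fin 9) :
    |(![2, 1, 1, 1, 0, 0, 0, 0, 0] : Fin 9 → ℝ) i| < 2 * a := by
  fin_cases i <;> simp <;> linarith

lemma integrable_expTail_sq {a : ℝ} (ha : 1 < a) :
    Integrable (fun p => expTail ⟪p.1, p.2⟫ ^ 2) (weightProd d a) := by
  simp only [expTail_sq]
  exact integrable_finsetSum _ fun i _ =>
    (integrable_inner_pow_mul_exp (abs_expTail_exponent_lt ha i) _).const_mul _

lemma integral_expTail_sq {a η : ℝ} (ha : 1 < a) (hη : η = 4 * a ^ 2 - 1) :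
    ∫ p, expTail ⟪p.1, p.2⟫ ^ 2 ∂(weightProd d a) = Real.pi ^ d *
      (1 / (a ^ 2 - 1) ^ ((d : ℝ) / 2) - 2 ^ (d + 1) / η ^ ((d : ℝ) / 2)
        - 3 * d * 2 ^ d / η ^ ((d : ℝ) / 2 + 1)
        - d * (d + 2) * 2 ^ d / η ^ ((d : ℝ) / 2 + 2)
        + 1 / a ^ d + d / (2 * a ^ (d + 2)) + 3 * d * (d + 2) / (64 * a ^ (d + 4))) := by
  have h0 : |(0 : ℝ)| < 2 * a := by simp; linarith
  have h1 : |(1 : ℝ)| < 2 * a := by simp; linarith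
  have h2 : |(2 : ℝ)| < 2 * a := by simp; linarith
  have hη0 : 0 < η := by nlinarith
  have ha0 : 0 < a := by linarith
  simp only [expTail_sq]
  rw [integral_finsetSum _ fun i _ =>
    (integrable_inner_pow_mul_exp (abs_expTail_exponent_lt ha i) _).const_mul _]
  simp only [integral_const_mul]
  have e1 : a ^ 2 - 1 ^ 2 / 4 = η / 4 := by rw [hη]; ring
  have e2 : a ^ 2 - 2 ^ 2 / 4 = a ^ 2 - 1 := by ring
  have e0 : a ^ 2 - 0 ^ 2 / 4 = a ^ 2 := by ring
  have p0 := div_four_rpow (d := d) hη0 0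
  have p1 := div_four_rpow (d := d) hη0 1
  have p2 := div_four_rpow (d := d) hη0 2
  have q0 := sq_rpow (d := d) ha0 0
  have q1 := sq_rpow (d := d) ha0 1
  have q2 := sq_rpow (d := d) ha0 2
  have r0 := Real.rpow_neg (show 0 ≤ a ^ 2 - 1 by nlinarith) ((d : ℝ) / 2)
  simp only [Nat.cast_zero, sub_zero, add_zero, Nat.cast_one, Nat.cast_ofNat, mul_zero, mul_one]
    at p0 p1 p2 q0 q1 q2
  have I02 := integral_exp_inner_eq (d := d) h2
  have I01 := integral_exp_inner_eq (d := d) h1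
  have I11 := integral_inner_mul_exp (d := d) h1
  have I21 := integral_inner_pow_two_mul_exp (d := d) h1
  have I00 := integral_exp_inner_eq (d := d) h0
  have I10 := integral_inner_mul_exp (d := d) h0
  have I20 := integral_inner_pow_two_mul_exp (d := d) h0
  have I30 := integral_inner_pow_three_mul_exp (d := d) h0
  have I40 := integral_inner_pow_four (d := d) ha0
  rw [e2, r0] at I02
  rw [e1] at I01 I11 I21
  rw [e0] at I00 I10 I20 I30
  rw [p0] at I01
  rw [p1] at I11
  rw [p1, p2] at I21
  rw [q0] at I00
  rw [q1] at I20
  rw [q2] at I40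
  rw [Fin.sum_univ_castSucc, Fin.sum_univ_eight]
  change 1 * (∫ p, ⟪p.1, p.2⟫ ^ 0 * Real.exp (2 * ⟪p.1, p.2⟫) ∂(weightProd d a))
    + -2 * (∫ p, ⟪p.1, p.2⟫ ^ 0 * Real.exp (1 * ⟪p.1, p.2⟫) ∂(weightProd d a))
    + -2 * (∫ p, ⟪p.1, p.2⟫ ^ 1 * Real.exp (1 * ⟪p.1, p.2⟫) ∂(weightProd d a))
    + -1 * (∫ p, ⟪p.1, p.2⟫ ^ 2 * Real.exp (1 * ⟪p.1, p.2⟫) ∂(weightProd d a))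
    + 1 * (∫ p, ⟪p.1, p.2⟫ ^ 0 * Real.exp (0 * ⟪p.1, p.2⟫) ∂(weightProd d a))
    + 2 * (∫ p, ⟪p.1, p.2⟫ ^ 1 * Real.exp (0 * ⟪p.1, p.2⟫) ∂(weightProd d a))
    + 2 * (∫ p, ⟪p.1, p.2⟫ ^ 2 * Real.exp (0 * ⟪p.1, p.2⟫) ∂(weightProd d a))
    + 1 * (∫ p, ⟪p.1, p.2⟫ ^ 3 * Real.exp (0 * ⟪p.1, p.2⟫) ∂(weightProd d a))
    + 1 / 4 * (∫ p, ⟪p.1, p.2⟫ ^ 4 * Real.exp (0 * ⟪p.1, p.2⟫) ∂(weightProd d a)) = _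
  rw [I02, I01, I11, I21, I00, I10, I20, I30, I40]
  have n0 := (Real.rpow_pos_of_pos hη0 ((d : ℝ) / 2)).ne'
  have n1 := (Real.rpow_pos_of_pos hη0 ((d : ℝ) / 2 + 1)).ne'
  have n2 := (Real.rpow_pos_of_pos hη0 ((d : ℝ) / 2 + 2)).ne'
  have n3 := (Real.rpow_pos_of_pos (show 0 < a ^ 2 - 1 by nlinarith) ((d : ℝ) / 2)).ne'
  -- The remaining identity is linear in the reciprocals of these powers, so no relation between
  -- them is needed.
  generalize η ^ ((d : ℝ) / 2) = x0 at *
  generalize η ^ ((d : ℝ) / 2 + 1) = x1 at *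
  generalize η ^ ((d : ℝ) / 2 + 2) = x2 at *
  generalize (a ^ 2 - 1) ^ ((d : ℝ) / 2) = x3 at *
  norm_num
  rw [pow_add a d 2, pow_add a d 4, pow_succ (2 : ℝ) d]
  field_simp
  ring

lemma integral_integral_limitKernel_sq (hβ : 2 < β) {η : ℝ} (hη : η = 4 * (β - 1) ^ 2 - 1) :
    ∫ s, ∫ t, limitKernel s t ^ 2 ∂(weightMeasure d β) ∂(weightMeasure d β) = Real.pi ^ d *
      (1 / (β * (β - 2)) ^ ((d : ℝ) / 2) - 2 ^ (d + 1) / η ^ ((d : ℝ) / 2)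
        - 3 * d * 2 ^ d / η ^ ((d : ℝ) / 2 + 1)
        - d * (d + 2) * 2 ^ d / η ^ ((d : ℝ) / 2 + 2)
        + 1 / (β - 1) ^ d + d / (2 * (β - 1) ^ (d + 2))
        + 3 * d * (d + 2) / (64 * (β - 1) ^ (d + 4))) := by
  have ha : 1 < β - 1 := by linarith
  rw [show β * (β - 2) = (β - 1) ^ 2 - 1 by ring, ← integral_expTail_sq ha hη,
    integral_prod _ (integrable_expTail_sq ha)]
  -- The factors exp(‖s‖²) and exp(‖t‖²) of C² lower the weight parameter from β to β - 1.
  simp only [limitKernel_sq, integral_const_mul, integral_exp_mul_weightMeasure]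

end KernelIntegrals

/-! ### Interchange of nonnegative sums and integrals. -/

lemma MeasureTheory.hasSum_integral_of_nonneg {α ι : Type*} {mα : MeasurableSpace α}
    {μ : Measure α} [Countable ι] {F : ι → α → ℝ} {G : α → ℝ} (hF : ∀ i, Integrable (F i) μ)
    (hnn : ∀ i a, 0 ≤ F i a) (hs : ∀ a, HasSum (fun i => F i a) (G a)) (hG : Integrable G μ) :
    HasSum (fun i => ∫ a, F i a ∂μ) (∫ a, G a ∂μ) := by
  have hsum : Summable fun i => ∫ a, F i a ∂μ := by
    refine summable_of_sum_le (c := ∫ a, G a ∂μ) (fun i => integral_nonneg (hnn i)) fun u => ?_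
    rw [← integral_finsetSum _ fun i _ => hF i]
    exact integral_mono (integrable_finsetSum _ fun i _ => hF i) hG
      fun a => sum_le_hasSum _ (fun i _ => hnn i a) (hs a)
  have h := hasSum_integral_of_summable_integral_norm hF (by
    simpa only [Real.norm_of_nonneg (hnn _ _)] using hsum)
  simpa only [(hs _).tsum_eq] using h

lemma hasSum_prod_of_nonneg {ι κ : Type*} {f : ι × κ → ℝ} (hf : ∀ p, 0 ≤ f p) {g : ι → ℝ} {a : ℝ}
    (h : ∀ i, HasSum (fun k => f (i, k)) (g i)) (hg : HasSum g a) : HasSum f a := by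
  have hs : Summable f := (summable_prod_of_nonneg hf).2
    ⟨fun i => (h i).summable, hg.summable.congr fun i => (h i).tsum_eq.symm⟩
  exact (hs.hasSum.prod_fiberwise h).unique hg ▸ hs.hasSum

lemma HasSum.comm_of_nonneg {ι κ : Type*} {f : ι → κ → ℝ} (hf : ∀ i k, 0 ≤ f i k) {g : ι → ℝ}
    {g' : κ → ℝ} {a : ℝ} (h : ∀ i, HasSum (fun k => f i k) (g i)) (hg : HasSum g a)
    (h' : ∀ k, HasSum (fun i => f i k) (g' k)) : HasSum g' a := by
  have := hasSum_prod_of_nonneg (f := fun p : ι × κ => f p.1 p.2) (fun _ => hf _ _) h hg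
  exact ((Equiv.prodComm κ ι).hasSum_iff.2 this).prod_fiberwise h'

/-! ### Square integrable kernels and Parseval. -/

section HilbertSchmidt

variable {X : Type*} {mX : MeasurableSpace X} {μ : Measure X}

lemma MeasureTheory.MemLp.inner_toLp {f : X → ℝ} (hf : MemLp f 2 μ) (g : Lp ℝ 2 μ) :
    ⟪hf.toLp f, g⟫ = ∫ x, f x * g x ∂μ := by
  rw [L2.inner_def]
  refine integral_congr_ae ?_
  filter_upwards [hf.coeFn_toLp] with x hx
  simp [hx, mul_comm]

lemma MeasureTheory.MemLp.norm_sq_toLp {f : X → ℝ} (hf : MemLp f 2 μ) :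
    ‖hf.toLp f‖ ^ 2 = ∫ x, f x ^ 2 ∂μ := by
  rw [← real_inner_self_eq_norm_sq, hf.inner_toLp]
  refine integral_congr_ae ?_
  filter_upwards [hf.coeFn_toLp] with x hx
  rw [hx, sq]

lemma MeasureTheory.MemLp.integral_norm_mul_le {f : X → ℝ} (hf : MemLp f 2 μ) (g : Lp ℝ 2 μ) :
    ∫ x, ‖f x * g x‖ ∂μ ≤ ‖hf.toLp f‖ * ‖g‖ := by
  have h := (le_abs_self _).trans (abs_real_inner_le_norm |hf.toLp f| |g|)
  rw [norm_abs_eq_norm, norm_abs_eq_norm] at h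
  refine le_of_eq_of_le ?_ h
  rw [L2.inner_def]
  refine integral_congr_ae ?_
  filter_upwards [hf.coeFn_toLp, Lp.coeFn_abs (hf.toLp f), Lp.coeFn_abs g] with x h1 h2 h3
  rw [h2, h3, h1, norm_mul]
  simp [mul_comm]

variable [SFinite μ] {C : X → X → ℝ}

lemma MeasureTheory.memLp_integral_kernel (hCm : Measurable (Function.uncurry C))
    (hC : ∀ s, MemLp (C s) 2 μ)
    (hC2 : Integrable (fun p : X × X => C p.1 p.2 ^ 2) (μ.prod μ)) (f : Lp ℝ 2 μ) :
    MemLp (fun s => ∫ t, C s t * f t ∂μ) 2 μ := by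
  have hmeas : AEStronglyMeasurable (fun s => ∫ t, C s t * f t ∂μ) μ := by
    refine AEStronglyMeasurable.integral_prod_right' (f := fun p : X × X => C p.1 p.2 * f p.2) ?_
    exact hCm.aestronglyMeasurable.mul (Lp.aestronglyMeasurable f).comp_snd
  refine (memLp_two_iff_integrable_sq hmeas).2 ?_
  refine (hC2.integral_prod_left.mul_const (‖f‖ ^ 2)).mono' (hmeas.pow 2)
    (.of_forall fun s => ?_)
  rw [← (hC s).inner_toLp, ← (hC s).norm_sq_toLp, ← mul_pow, norm_pow]
  exact pow_le_pow_left₀ (norm_nonneg _) (abs_real_inner_le_norm _ _) 2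

/-- The Hilbert-Schmidt norm of a square integrable kernel, computed in a Hilbert basis. -/
lemma HilbertBasis.hasSum_sq_kernel {ι : Type*} [Countable ι] (b : HilbertBasis ι ℝ (Lp ℝ 2 μ))
    (hCm : Measurable (Function.uncurry C)) (hC : ∀ s, MemLp (C s) 2 μ)
    (hC2 : Integrable (fun p : X × X => C p.1 p.2 ^ 2) (μ.prod μ)) :
    HasSum (fun p : ι × ι => (∫ s, ∫ t, C s t * b p.2 s * b p.1 t ∂μ ∂μ) ^ 2)
      (∫ s, ∫ t, C s t ^ 2 ∂μ ∂μ) := by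
  have hK (f : Lp ℝ 2 μ) := memLp_integral_kernel hCm hC hC2 f
  -- For fixed j, Parseval for the image of b_j under the kernel; then, for fixed s, Parseval for
  -- C(s,·) summed over j.
  refine hasSum_prod_of_nonneg (fun _ => sq_nonneg _)
    (g := fun j => ∫ s, (∫ t, C s t * b j t ∂μ) ^ 2 ∂μ) (fun j => ?_) ?_
  · have h := b.hasSum_sq_inner ((hK (b j)).toLp _)
    rw [(hK (b j)).norm_sq_toLp] at h
    refine h.congr_fun fun i => ?_
    rw [real_inner_comm, (hK (b j)).inner_toLp]
    congr 2 with s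
    rw [← integral_mul_const]
    congr 1 with t
    ring
  · refine hasSum_integral_of_nonneg (fun j => (hK (b j)).integrable_sq) (fun _ _ => sq_nonneg _)
      (fun s => ?_) hC2.integral_prod_left
    have h := b.hasSum_sq_inner ((hC s).toLp _)
    rw [(hC s).norm_sq_toLp] at h
    refine h.congr_fun fun i => ?_
    rw [real_inner_comm, (hC s).inner_toLp]

end HilbertSchmidt

/-! ### Rank-one expansion of the kernel. -/

section Feature

variable {d : ℕ} {β : ℝ}

/-- The functions `h` with `C (s, t) = ∑ h(s) h(t)` for the kernel `limitKernel`, indexed by the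
words of length at least three in the coordinates. -/
noncomputable def kernelFeature (k : Σ n : ℕ, (Fin (n + 3) → Fin d))
    (t : EuclideanSpace ℝ (Fin d)) : ℝ :=
  Real.exp (‖t‖ ^ 2 / 2) * (∏ j, t (k.2 j)) / √((k.1 + 3).factorial : ℝ)

lemma continuous_kernelFeature (k : Σ n : ℕ, (Fin (n + 3) → Fin d)) :
    Continuous (kernelFeature k) := by
  unfold kernelFeature; fun_prop

lemma hasSum_expTail (x : ℝ) :
    HasSum (fun n : ℕ => x ^ (n + 3) / ((n + 3).factorial : ℝ)) (expTail x) := by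
  have h : HasSum (fun n : ℕ => x ^ n / (n.factorial : ℝ)) (Real.exp x) := by
    rw [Real.exp_eq_exp_ℝ]; exact NormedSpace.expSeries_div_hasSum_exp x
  have := (hasSum_nat_add_iff' 3).2 h
  simp only [Finset.sum_range_succ, Finset.sum_range_zero] at this
  have e : expTail x = Real.exp x - (0 + x ^ 0 / (Nat.factorial 0 : ℝ) +
      x ^ 1 / (Nat.factorial 1 : ℝ) + x ^ 2 / (Nat.factorial 2 : ℝ)) := by
    unfold expTail
    norm_num
    ring
  rw [e]
  exact this

/-- Expanding (Σ s_i t_i)^(n+3) over words rather than multi-indices avoids multinomial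
coefficients. -/
lemma sum_kernelFeature_mul (n : ℕ) (s t : EuclideanSpace ℝ (Fin d)) :
    ∑ w : Fin (n + 3) → Fin d, kernelFeature ⟨n, w⟩ s * kernelFeature ⟨n, w⟩ t =
      Real.exp ((‖s‖ ^ 2 + ‖t‖ ^ 2) / 2) * (⟪s, t⟫ ^ (n + 3) / ((n + 3).factorial : ℝ)) := by
  have hinner : ⟪s, t⟫ = ∑ i, s i * t i := by
    simp [PiLp.inner_apply, mul_comm]
  rw [hinner, Fintype.sum_pow, Finset.sum_div, Finset.mul_sum]
  refine Finset.sum_congr rfl fun w _ => ?_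
  have hsq : √((n + 3).factorial : ℝ) * √((n + 3).factorial : ℝ) = ((n + 3).factorial : ℝ) :=
    Real.mul_self_sqrt (Nat.cast_nonneg _)
  simp only [kernelFeature]
  rw [div_mul_div_comm, hsq, add_div, Real.exp_add, Finset.prod_mul_distrib]
  ring

lemma summable_kernelFeature_sq (t : EuclideanSpace ℝ (Fin d)) :
    Summable fun k : Σ n : ℕ, (Fin (n + 3) → Fin d) => kernelFeature k t * kernelFeature k t := by
  refine (summable_sigma_of_nonneg fun _ => mul_self_nonneg _).2
    ⟨fun n => (hasSum_fintype _).summable, ?_⟩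
  simp only [tsum_fintype, sum_kernelFeature_mul]
  exact (hasSum_expTail _).summable.mul_left _

/-- The expansion of the kernel into products of features. -/
lemma hasSum_kernelFeature_mul (s t : EuclideanSpace ℝ (Fin d)) :
    HasSum (fun k : Σ n : ℕ, (Fin (n + 3) → Fin d) => kernelFeature k s * kernelFeature k t)
      (limitKernel s t) := by
  refine HasSum.sigma_of_hasSum ((hasSum_expTail ⟪s, t⟫).mul_left _) (fun n => ?_) ?_
  · rw [← sum_kernelFeature_mul]
    exact hasSum_fintype _
  -- |xy| ≤ x² + y² reduces absolute summability to the diagonal, where all terms are nonnegative.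
  · refine Summable.of_norm_bounded
      ((summable_kernelFeature_sq s).add (summable_kernelFeature_sq t)) fun k => ?_
    rw [Real.norm_eq_abs, abs_le]
    constructor <;>
    nlinarith [sq_nonneg (kernelFeature k s + kernelFeature k t),
      sq_nonneg (kernelFeature k s - kernelFeature k t)]

lemma memLp_kernelFeature (hβ : 2 < β) (k : Σ n : ℕ, (Fin (n + 3) → Fin d)) :
    MemLp (kernelFeature k) 2 (weightMeasure d β) := by
  have hm := (continuous_kernelFeature k).aestronglyMeasurable (μ := weightMeasure d β)
  refine (memLp_two_iff_integrable_sq hm).2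
    ((integrable_limitKernel_self hβ).mono' (hm.pow 2) (.of_forall fun t => ?_))
  rw [Real.norm_of_nonneg (sq_nonneg _), sq]
  exact le_hasSum (hasSum_kernelFeature_mul t t) k fun _ _ => mul_self_nonneg _

/-- The feature `kernelFeature k` as an element of `L²_β`. -/
noncomputable def kernelFeatureLp (hβ : 2 < β) (k : Σ n : ℕ, (Fin (n + 3) → Fin d)) :
    L2Weight d β :=
  (memLp_kernelFeature hβ k).toLp _

lemma hasSum_norm_sq_kernelFeatureLp (hβ : 2 < β) :
    HasSum (fun k => ‖kernelFeatureLp (d := d) hβ k‖ ^ 2)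
      (∫ t, limitKernel t t ∂(weightMeasure d β)) := by
  simp only [kernelFeatureLp, MemLp.norm_sq_toLp]
  refine hasSum_integral_of_nonneg (fun k => (memLp_kernelFeature hβ k).integrable_sq)
    (fun _ _ => sq_nonneg _) (fun t => ?_) (integrable_limitKernel_self hβ)
  simpa only [sq] using hasSum_kernelFeature_mul t t

lemma abs_expTail_le (x : ℝ) : |expTail x| ≤ Real.exp |x| := by
  rw [← (hasSum_expTail x).tsum_eq, ← Real.norm_eq_abs]
  have h := hasSum_expTail |x|
  refine (tsum_of_norm_bounded h fun n => ?_).trans ?_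
  · rw [norm_div, norm_pow, Real.norm_eq_abs, Real.norm_of_nonneg (Nat.cast_nonneg _)]
  · unfold expTail
    nlinarith [abs_nonneg x, sq_nonneg |x|]

lemma limitKernel_sq_le (s t : EuclideanSpace ℝ (Fin d)) :
    limitKernel s t ^ 2 ≤ Real.exp (2 * ‖s‖ ^ 2) * Real.exp (2 * ‖t‖ ^ 2) := by
  have h1 : expTail ⟪s, t⟫ ^ 2 ≤ Real.exp (‖s‖ ^ 2 + ‖t‖ ^ 2) := by
    rw [← sq_abs]
    refine (pow_le_pow_left₀ (abs_nonneg _) (abs_expTail_le _) 2).trans ?_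
    rw [← Real.exp_nat_mul]
    refine Real.exp_le_exp.2 ?_
    push_cast
    nlinarith [abs_real_inner_le_norm s t, sq_nonneg (‖s‖ - ‖t‖)]
  rw [limitKernel_sq, ← mul_assoc, ← Real.exp_add, ← Real.exp_add]
  refine (mul_le_mul_of_nonneg_left h1 (Real.exp_nonneg _)).trans (le_of_eq ?_)
  rw [← Real.exp_add]
  ring_nf

lemma integrable_limitKernel_sq (hβ : 2 < β) :
    Integrable (fun p => limitKernel p.1 p.2 ^ 2) (weightProd d β) := by
  have h := integrable_exp_mul_sq_norm (d := d) hβ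
  refine (h.mul_prod h).mono' (continuous_limitKernel.pow 2).aestronglyMeasurable
    (.of_forall fun p => ?_)
  rw [Real.norm_of_nonneg (sq_nonneg _)]
  exact limitKernel_sq_le p.1 p.2

lemma memLp_limitKernel (hβ : 2 < β) (s : EuclideanSpace ℝ (Fin d)) :
    MemLp (limitKernel s) 2 (weightMeasure d β) := by
  have hm : Continuous fun t => limitKernel s t := by unfold limitKernel; fun_prop
  refine (memLp_two_iff_integrable_sq hm.aestronglyMeasurable).2 ?_
  refine ((integrable_exp_mul_sq_norm (d := d) hβ).const_mul (Real.exp (2 * ‖s‖ ^ 2))).mono'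
    (hm.pow 2).aestronglyMeasurable (.of_forall fun t => ?_)
  rw [Real.norm_of_nonneg (sq_nonneg _)]
  exact limitKernel_sq_le s t

/-- The covariance form of the kernel, expanded in the features. -/
lemma hasSum_inner_kernelFeatureLp (hβ : 2 < β) (f g : L2Weight d β) :
    HasSum (fun k => ⟪f, kernelFeatureLp hβ k⟫ * ⟪g, kernelFeatureLp hβ k⟫)
      (∫ s, ∫ t, limitKernel s t * f s * g t ∂(weightMeasure d β) ∂(weightMeasure d β)) := by
  have hφ (k : Σ n : ℕ, (Fin (n + 3) → Fin d)) (f : L2Weight d β) :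
      Integrable (fun s => kernelFeature k s * f s) (weightMeasure d β) :=
    (memLp_kernelFeature hβ k).integrable_mul (Lp.memLp f)
  have hfg : MemLp (fun p : EuclideanSpace ℝ (Fin d) × EuclideanSpace ℝ (Fin d) => f p.1 * g p.2)
      2 (weightProd d β) := by
    have hm : AEStronglyMeasurable
        (fun p : EuclideanSpace ℝ (Fin d) × EuclideanSpace ℝ (Fin d) => f p.1 * g p.2)
        (weightProd d β) :=
      (Lp.aestronglyMeasurable f).comp_fst.mul (Lp.aestronglyMeasurable g).comp_snd
    rw [memLp_two_iff_integrable_sq hm]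
    simp only [mul_pow]
    exact (Lp.memLp f).integrable_sq.mul_prod (Lp.memLp g).integrable_sq
  have hC : MemLp (fun p : EuclideanSpace ℝ (Fin d) × EuclideanSpace ℝ (Fin d) =>
      limitKernel p.1 p.2) 2 (weightProd d β) :=
    (memLp_two_iff_integrable_sq continuous_limitKernel.aestronglyMeasurable).2
      (integrable_limitKernel_sq hβ)
  have hint : Integrable (fun p : EuclideanSpace ℝ (Fin d) × EuclideanSpace ℝ (Fin d) =>
      limitKernel p.1 p.2 * (f p.1 * g p.2)) (weightProd d β) := hC.integrable_mul hfg
  have hsummable : Summable fun k => ∫ p : EuclideanSpace ℝ (Fin d) × EuclideanSpace ℝ (Fin d),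
      ‖(kernelFeature k p.1 * f p.1) * (kernelFeature k p.2 * g p.2)‖ ∂(weightProd d β) := by
    -- By Cauchy–Schwarz each term is at most ‖h_k‖² ‖f‖ ‖g‖.
    refine Summable.of_nonneg_of_le (fun _ => integral_nonneg fun _ => norm_nonneg _) (fun k => ?_)
      ((hasSum_norm_sq_kernelFeatureLp (d := d) hβ).summable.mul_right (‖f‖ * ‖g‖))
    have e := integral_prod_mul (μ := weightMeasure d β) (ν := weightMeasure d β)
      (fun s => ‖kernelFeature k s * f s‖) (fun t => ‖kernelFeature k t * g t‖)
    simp only [norm_mul (kernelFeature k _ * f _), e]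
    refine (mul_le_mul ((memLp_kernelFeature hβ k).integral_norm_mul_le f)
      ((memLp_kernelFeature hβ k).integral_norm_mul_le g)
      (integral_nonneg fun _ => norm_nonneg _)
      (mul_nonneg (norm_nonneg _) (norm_nonneg _))).trans (le_of_eq ?_)
    simp only [kernelFeatureLp]
    ring
  have hsum := hasSum_integral_of_summable_integral_norm
    (fun k => (hφ k f).mul_prod (hφ k g)) hsummable
  have heq : ∫ p, ∑' k, (kernelFeature k p.1 * f p.1) * (kernelFeature k p.2 * g p.2) ∂(weightProd d β)
      = ∫ s, ∫ t, limitKernel s t * f s * g t ∂(weightMeasure d β)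
        ∂(weightMeasure d β) := by
    simp only [mul_assoc]
    rw [← integral_prod _ hint]
    congr 1 with p
    have h := (hasSum_kernelFeature_mul p.1 p.2).mul_right (f p.1 * g p.2)
    rw [← h.tsum_eq]
    congr 1 with k
    ring
  rw [heq] at hsum
  refine hsum.congr_fun fun k => ?_
  rw [integral_prod_mul (fun s => kernelFeature k s * f s) (fun t => kernelFeature k t * g t),
    real_inner_comm, real_inner_comm _ g]
  simp only [kernelFeatureLp, MemLp.inner_toLp]

end Feature

/-! ### Trace and Hilbert–Schmidt norm of the covariance, and conclusion. -/

instance (d : ℕ) (β : ℝ) : SecondCountableTopology (L2Weight d β) := by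
  have : Fact ((2 : ℝ≥0∞) ≠ ∞) := ⟨by simp⟩
  infer_instance

namespace IsCentredGaussianWithKernel

variable {d : ℕ} {β : ℝ} {Ω : Type*} [MeasurableSpace Ω] {P : Measure Ω} {W : Ω → L2Weight d β}

lemma integral_inner_mul_inner {C : EuclideanSpace ℝ (Fin d) → EuclideanSpace ℝ (Fin d) → ℝ}
    (hW : IsCentredGaussianWithKernel C W P) (f g : L2Weight d β) :
    ∫ ω, ⟪f, W ω⟫ * ⟪g, W ω⟫ ∂P =
      ∫ s, ∫ t, C s t * f s * g t ∂(weightMeasure d β) ∂(weightMeasure d β) := by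
  rw [← hW.covariance_eq, hW.gaussian.covariance_inner hW.centred]

variable {ι : Type*} (b : HilbertBasis ι ℝ (L2Weight d β))

/-- The double series Σ⟪b_i, h_k⟫² is summed both ways: over i first it gives Σ‖h_k‖², over k first
the variances of the coordinates. -/
lemma hasSum_integral_sq_inner (hβ : 2 < β) (hW : IsCentredGaussianWithKernel limitKernel W P) :
    HasSum (fun i => ∫ ω, ⟪b i, W ω⟫ ^ 2 ∂P) (∫ t, limitKernel t t ∂(weightMeasure d β)) := by
  refine HasSum.comm_of_nonneg (f := fun k i => ⟪b i, kernelFeatureLp hβ k⟫ ^ 2)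
    (fun _ _ => sq_nonneg _) (fun k => b.hasSum_sq_inner _) (hasSum_norm_sq_kernelFeatureLp hβ)
    fun i => ?_
  simp only [sq]
  rw [hW.integral_inner_mul_inner]
  exact hasSum_inner_kernelFeatureLp hβ _ _

lemma hasSum_sq_integral_inner_mul_inner [Countable ι] (hβ : 2 < β)
    (hW : IsCentredGaussianWithKernel limitKernel W P) :
    HasSum (fun p : ι × ι => (∫ ω, ⟪b p.1, W ω⟫ * ⟪b p.2, W ω⟫ ∂P) ^ 2)
      (∫ s, ∫ t, limitKernel s t ^ 2 ∂(weightMeasure d β) ∂(weightMeasure d β)) := by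
  refine (b.hasSum_sq_kernel continuous_limitKernel.measurable (memLp_limitKernel hβ)
    (integrable_limitKernel_sq hβ)).congr_fun fun p => ?_
  rw [← hW.integral_inner_mul_inner]
  simp only [mul_comm]

end IsCentredGaussianWithKernel

theorem exists_isCentredGaussianWithKernel_limitKernel (d : ℕ) {β : ℝ} (hβ : 2 < β) :
    ∃ (Ω : Type) (_ : MeasurableSpace Ω) (P : Measure Ω) (_ : IsProbabilityMeasure P)
      (W : Ω → L2Weight d β), IsCentredGaussianWithKernel limitKernel W P := by
  obtain ⟨Ω, mΩ, P, hP, W, hW, h0, hcov⟩ :=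
    exists_hasGaussianLaw_of_summable (hasSum_norm_sq_kernelFeatureLp (d := d) hβ).summable
  refine ⟨Ω, mΩ, P, hP, W, hW.aemeasurable, hW, h0, fun f g => ?_⟩
  rw [hW.covariance_inner h0]
  exact (hcov f g).unique (hasSum_inner_kernelFeatureLp hβ f g)

theorem mainTheorem6 (d : ℕ) (hd : 1 ≤ d) (β : ℝ) (hβ : 2 < β) (η : ℝ)
    (hη : η = 4 * (β - 1) ^ 2 - 1) :
    (∃ (Ω : Type) (_ : MeasurableSpace Ω) (P : Measure Ω) (_ : IsProbabilityMeasure P)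
      (W : Ω → L2Weight d β), IsCentredGaussianWithKernel limitKernel W P) ∧
    ∀ (Ω : Type*) [MeasurableSpace Ω] (P : Measure Ω) [IsProbabilityMeasure P]
      (W : Ω → L2Weight d β), IsCentredGaussianWithKernel limitKernel W P →
      MemLp (fun ω => ‖W ω‖ ^ 2) 2 P ∧
      ∫ ω, ‖W ω‖ ^ 2 ∂P =
        Real.pi ^ ((d : ℝ) / 2) *
          (1 / (β - 2) ^ ((d : ℝ) / 2) - 1 / (β - 1) ^ ((d : ℝ) / 2)
            - d / (2 * (β - 1) ^ ((d : ℝ) / 2 + 1))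
            - d * (d + 2) / (8 * (β - 1) ^ ((d : ℝ) / 2 + 2))) ∧
      variance (fun ω => ‖W ω‖ ^ 2) P =
        2 * Real.pi ^ d *
          (1 / (β * (β - 2)) ^ ((d : ℝ) / 2) - 2 ^ (d + 1) / η ^ ((d : ℝ) / 2)
            - 3 * d * 2 ^ d / η ^ ((d : ℝ) / 2 + 1)
            - d * (d + 2) * 2 ^ d / η ^ ((d : ℝ) / 2 + 2)
            + 1 / (β - 1) ^ d + d / (2 * (β - 1) ^ (d + 2))
            + 3 * d * (d + 2) / (64 * (β - 1) ^ (d + 4))) := by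
  refine ⟨exists_isCentredGaussianWithKernel_limitKernel d hβ, fun Ω _ P _ W hW => ?_⟩
  obtain ⟨w, b, -⟩ := exists_hilbertBasis ℝ (L2Weight d β)
  have : Countable w := b.orthonormal.countable
  have hτ := hW.hasSum_integral_sq_inner b hβ
  have hκ := hW.hasSum_sq_integral_inner_mul_inner b hβ
  refine ⟨hW.gaussian.memLp_two_norm_sq, ?_, ?_⟩
  · rw [hW.gaussian.integral_norm_sq_eq b hτ, integral_limitKernel_self hβ]
  · rw [hW.gaussian.variance_norm_sq_eq b hW.centred hτ hκ,
      integral_integral_limitKernel_sq hβ hη, ← mul_assoc]
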